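/- **Conventions.** A function $\varepsilon:\mathbb N\to\mathbb R$ is negligible if $k^{d}\,\varepsilon(k)\to 0$ for every $d\in\mathbb N$. An interval function on $n$ bits is a map $I_{[a,b]}:\{0,1\}^n\to\{0,1\}$, with integers $0\le a<b<2^n$, that is $1$ exactly on the strings $x$ which, read as integers in binary, lie in $[a,b]$. The size $|C|$ of a Boolean circuit $C$ (fan-in-two gates, one output bit) is its number of inputs and gates. Let $\mathcal I$ be a class of circuits that compute interval functions and that contains, for every interval function on $n$ bits, a circuit of size at most $p(n)$ for some fixed polynomial $p$ (for instance the class of all circuits that compute interval functions). A transmission $O(C)$ consists of finitely many rounds; in each round the sender sends a quantum message of some number of qubits, produced from its memory. The memory bounds apply after each round (and before the first one): a party with qmemory $t$ must then reduce its stored state to a cq-state $\sum_y p_y|y\rangle\langle y|\otimes\rho_y$ with at most $t$ qubits. Otherwise the parties are unrestricted (arbitrary quantum channels, arbitrary finite classical memory). Receivers know the input length of $C$, the size $|C|$, and the number of rounds and message lengths. The bounds $q,r,\mathtt s$ may be functions of $|C|$. A family of transmissions $O_{\mathtt s}(C)$ is a $(q,r,\mathtt s)$-BQS obfuscator of $\mathcal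 I$ if: 1. some receiver with qmemory $r$ obtains, for every $C\in\mathcal I$ and every input $x$ of its choice, the value $C(x)$ from $O_{\mathtt s}(C)$ except with probability negligible in $|C|$; 2. the total number of qubits of $O_{\mathtt s}(C)$ is at most polynomial in $|C|$; 3. the sender needs qmemory at most $q$; 4. for every computationally unbounded adversary $\mathcal A$ with qmemory $\mathtt s$ and one-bit output there are a computationally unbounded quantum simulator $\mathcal S$ with qmemory $\mathtt s$ (at whatever fixed set of points between its queries the bound is taken to apply), making at most polynomially many (in $|C|$) quantum queries to an oracle for $C$, and a negligible $\varepsilon$ such that for all $C\in\mathcal I$ $$\bigl|\Pr[\mathcal A(O_{\mathtt s}(C))=1]-\Pr[\mathcal S^{C}(|0\rangle^{\otimes|C|})=1]\bigr|\le\varepsilon(|C|).$$ **Theorem.** Let $O_{\mathtt s}$ be a $(q,r,\mathtt s)$-BQS obfuscator of $\mathcal I$. There do not exist computationally unbounded algorithms $\mathcal A_{\mathtt s}$ (a receiver with qmemory $\mathtt s$) and $\mathcal A_{\mathtt s}'$ (a quantum channel with one-qubit output, for each input length, circuit size and transmission shape) and a negligible function $\varepsilon$ such that for every $C\in\mathcal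 I$: 1. after the transmission $O_{\mathtt s}(C)$, $\mathcal A_{\mathtt s}$ holds a cq-state $\rho_C$ with at most $\mathtt s(|C|)$ qubits; and 2. for every input $x$ of $C$, $$\bigl\|\mathcal A_{\mathtt s}'(\rho_C\otimes|x\rangle\langle x|)-|C(x)\rangle\langle C(x)|\bigr\|_1\le\varepsilon(|C|).$$ -/

import Mathlib

noncomputable section

open Matrix

namespace BQS

/-! ### Boolean circuits and interval functions -/

/-- Bit strings of length `n`; also the computational basis of an `n`-qubit register. -/
abbrev Bits (n : ℕ) : Type := Fin n → Bool

/-- Straight-line Boolean programs with `n` inputs and `k` wires in total: the inputs are the first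
`n` wires, and each fan-in-two gate reads two existing wires and creates a new one. -/
inductive Netlist (n : ℕ) : ℕ → Type
  | inputs : Netlist n n
  | gate {k : ℕ} (c : Netlist n k) (g : Bool → Bool → Bool) (i j : Fin k) : Netlist n (k + 1)

/-- The values of all wires on the input `x`. -/
def Netlist.eval {n : ℕ} (x : Bits n) : {k : ℕ} → Netlist n k → Fin k → Bool
  | _, .inputs => x
  | _, .gate c g i j => Fin.snoc (α := fun _ => Bool) (c.eval x) (g (c.eval x i) (c.eval x j))

/-- A Boolean circuit with `n` input bits and one output bit. Its size `|C|` is the number of its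
wires (inputs and gates). -/
structure BoolCircuit (n : ℕ) where
  size : ℕ
  net : Netlist n size
  out : Fin size

/-- The function computed by a circuit. -/
def BoolCircuit.eval {n : ℕ} (C : BoolCircuit n) (x : Bits n) : Bool := C.net.eval x C.out

/-- `f` is the indicator of `[a, b]` with `a < b`, where an `n`-bit string is read as an integer in
`{0, …, 2 ^ n - 1}` through its binary expansion. -/
def IsIntervalFunction {n : ℕ} (f : Bits n → Bool) : Prop :=
  ∃ a b : ℕ, a < b ∧ b < 2 ^ n ∧ ∀ x, f x = decide (a ≤ Nat.ofBits x ∧ Nat.ofBits x ≤ b)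

/-- A class of circuits implements the interval functions if all its members compute interval
functions and every interval function is computed by a member of size polynomial in the input
length. (The class of all circuits that compute interval functions is an example, and so is the
class that holds one comparator circuit for each interval.) -/
def IsIntervalClass (𝓘 : (n : ℕ) → Set (BoolCircuit n)) : Prop :=
  (∀ n, ∀ C ∈ 𝓘 n, IsIntervalFunction C.eval) ∧
  ∃ p : Polynomial ℕ, ∀ n, ∀ f : Bits n → Bool, IsIntervalFunction f →
    ∃ C ∈ 𝓘 n, C.eval = f ∧ C.size ≤ p.eval n

/-- Negligible functions: smaller than the inverse of every polynomial for large arguments. -/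
def Negligible (ε : ℕ → ℝ) : Prop :=
  Asymptotics.SuperpolynomialDecay Filter.atTop (fun k : ℕ => (k : ℝ)) ε

/-! ### States and channels on finite-dimensional systems -/

/-- A quantum channel (completely positive trace-preserving map), given by Kraus operators. -/
structure QChannel (α β : Type) [Fintype α] [DecidableEq α] [Fintype β] where
  num : ℕ
  kraus : Fin num → Matrix β α ℂ
  complete : ∑ i, (kraus i)ᴴ * kraus i = 1

section Channels

variable {α β γ : Type} [Fintype α] [DecidableEq α] [Fintype β]

/-- The action of a channel on an operator. -/
def QChannel.apply (Φ : QChannel α β) (ρ : Matrix α α ℂ) : Matrix β β ℂ :=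
  ∑ i, Φ.kraus i * ρ * (Φ.kraus i)ᴴ

/-- The action of `Φ ⊗ id` on a bipartite operator. -/
def QChannel.applyLeft [Fintype γ] [DecidableEq γ] (Φ : QChannel α β)
    (ρ : Matrix (α × γ) (α × γ) ℂ) : Matrix (β × γ) (β × γ) ℂ :=
  ∑ i, (kroneckerMap (· * ·) (Φ.kraus i) (1 : Matrix γ γ ℂ)) * ρ *
    (kroneckerMap (· * ·) (Φ.kraus i) (1 : Matrix γ γ ℂ))ᴴ

/-- The action of `id ⊗ Φ` on a bipartite operator. -/
def QChannel.applyRight [Fintype γ] [DecidableEq γ] (Φ : QChannel α β)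
    (ρ : Matrix (γ × α) (γ × α) ℂ) : Matrix (γ × β) (γ × β) ℂ :=
  ∑ i, (kroneckerMap (· * ·) (1 : Matrix γ γ ℂ) (Φ.kraus i)) * ρ *
    (kroneckerMap (· * ·) (1 : Matrix γ γ ℂ) (Φ.kraus i))ᴴ

end Channels

/-- The basis projection `|a⟩⟨a|`. -/
def proj {α : Type} [DecidableEq α] (a : α) : Matrix α α ℂ := Matrix.single a a 1

/-- The trace norm `tr √(M Mᴴ)`, that is, the sum of the square roots of the eigenvalues
of `M Mᴴ`. -/
def traceNorm {α : Type} [Fintype α] [DecidableEq α] (M : Matrix α α ℂ) : ℝ :=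
  ∑ i, √((isHermitian_mul_conjTranspose_self M).eigenvalues i)

/-- The partial trace over the first tensor factor. -/
def traceLeft {α β : Type} [Fintype α] (ρ : Matrix (α × β) (α × β) ℂ) : Matrix β β ℂ :=
  fun b b' => ∑ a, ρ (a, b) (a, b')

/-- The shape of a memory register: a classical part with `cl` values (arbitrary) and `qu`
qubits. -/
structure CQReg where
  cl : ℕ
  qu : ℕ

/-- The basis of a memory register. -/
abbrev CQReg.Basis (M : CQReg) : Type := Fin M.cl × Bits M.qu

/-- The classical part of a register is measured: the result is a cq-state
`∑ y, |y⟩⟨y| ⊗ ρ y`. -/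
def dephase {M : CQReg} (ρ : Matrix M.Basis M.Basis ℂ) : Matrix M.Basis M.Basis ℂ :=
  fun a b => if a.1 = b.1 then ρ a b else 0

/-- The classical parts of both registers of a bipartite system are measured. -/
def dephase₂ {M N : CQReg} (ρ : Matrix (M.Basis × N.Basis) (M.Basis × N.Basis) ℂ) :
    Matrix (M.Basis × N.Basis) (M.Basis × N.Basis) ℂ :=
  fun a b => if a.1.1 = b.1.1 ∧ a.2.1 = b.2.1 then ρ a b else 0

/-! ### Transmissions in the bounded quantum storage model -/

/-- The publicly visible shape of a transmission: the number of rounds and the number of qubits sent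
in each of them. The memory bounds apply after each round (and before the first one). Classical
messages are sent as qubits in a basis state. -/
structure Shape where
  rounds : ℕ
  len : Fin rounds → ℕ

/-- A sender. Between rounds it keeps a cq-register; in a round it acts on it by an arbitrary channel
that also produces the message of that round. -/
structure Transmission where
  shape : Shape
  mem : Fin (shape.rounds + 1) → CQReg
  init : QChannel Unit (mem 0).Basis
  step : (i : Fin shape.rounds) →
    QChannel (mem i.castSucc).Basis ((mem i.succ).Basis × Bits (shape.len i))

/-- The total number of qubits sent. -/
def Transmission.qubits (Θ : Transmission) : ℕ := ∑ i, Θ.shape.len i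

/-- A receiver for transmissions of a given shape. In a round it acts by an arbitrary channel on its
register and the message; whenever the memory bound applies, only a cq-register remains. -/
structure Receiver (sh : Shape) where
  mem : Fin (sh.rounds + 1) → CQReg
  init : QChannel Unit (mem 0).Basis
  step : (i : Fin sh.rounds) →
    QChannel ((mem i.castSucc).Basis × Bits (sh.len i)) (mem i.succ).Basis

/-- The register that is stored after the last round. -/
abbrev Receiver.final {sh : Shape} (A : Receiver sh) : CQReg := A.mem (Fin.last sh.rounds)

/-- The receiver never keeps more than `s` qubits when the memory bound applies; its classical memory
and its operations within a round are unrestricted. -/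
def Receiver.HasQMemory {sh : Shape} (A : Receiver sh) (s : ℕ) : Prop := ∀ i, (A.mem i).qu ≤ s

/-- The joint state of the memories of the sender and the receiver after `i` rounds. In each round
the sender produces a message, the receiver processes it, and the memory bounds apply. -/
def jointState (Θ : Transmission) (A : Receiver Θ.shape) (i : Fin (Θ.shape.rounds + 1)) :
    Matrix ((Θ.mem i).Basis × (A.mem i).Basis) ((Θ.mem i).Basis × (A.mem i).Basis) ℂ :=
  Fin.induction
    (motive := fun i =>
      Matrix ((Θ.mem i).Basis × (A.mem i).Basis) ((Θ.mem i).Basis × (A.mem i).Basis) ℂ)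
    (dephase₂ (kroneckerMap (· * ·) (Θ.init.apply 1) (A.init.apply 1)))
    (fun i ρ => dephase₂ ((A.step i).applyRight
      (((Θ.step i).applyLeft ρ).submatrix
        (fun a => ((a.1, a.2.2), a.2.1)) (fun a => ((a.1, a.2.2), a.2.1)))))
    i

/-- The cq-state that the receiver holds after the transmission. -/
def storedState (Θ : Transmission) (A : Receiver Θ.shape) :
    Matrix A.final.Basis A.final.Basis ℂ :=
  traceLeft (jointState Θ A (Fin.last Θ.shape.rounds))

/-- A computationally unbounded receiving algorithm with qmemory bound `s`. It knows the input length
`n` and the size `k` of the circuit, and sees the shape of the transmission. -/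
structure ReceiverFamily (s : ℕ → ℕ) where
  recv : (n k : ℕ) → (sh : Shape) → Receiver sh
  bound : ∀ n k sh, (recv n k sh).HasQMemory (s k)

/-- The probability that the one-qubit output of `D`, applied to the stored state and measured in the
computational basis, is `b`. -/
def outputProb (Θ : Transmission) (A : Receiver Θ.shape) (D : QChannel A.final.Basis Bool)
    (b : Bool) : ℝ :=
  (D.apply (storedState Θ A) b b).re

/-! ### Oracle algorithms -/

/-- A computationally unbounded quantum algorithm with input `k` qubits, a one-bit output, and a
number of queries to an oracle for a function on `n` bits. Between queries it keeps a
cq-register. -/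
structure OracleAlgorithm (n k : ℕ) where
  queries : ℕ
  mem : Fin (queries + 1) → CQReg
  work : Fin queries → ℕ
  init : QChannel (Bits k) (mem 0).Basis
  pre : (t : Fin queries) → QChannel (mem t.castSucc).Basis (Fin (work t) × Bits n × Bool)
  post : (t : Fin queries) → QChannel (Fin (work t) × Bits n × Bool) (mem t.succ).Basis
  out : QChannel (mem (Fin.last queries)).Basis Bool

/-- Conjugation with the oracle unitary `|x, b⟩ ↦ |x, b ⊕ f x⟩` on the last two registers. -/
def oracleCall {n : ℕ} {W : Type} (f : Bits n → Bool)
    (ρ : Matrix (W × Bits n × Bool) (W × Bits n × Bool) ℂ) :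
    Matrix (W × Bits n × Bool) (W × Bits n × Bool) ℂ :=
  ρ.submatrix (fun a => (a.1, a.2.1, xor a.2.2 (f a.2.1)))
    (fun a => (a.1, a.2.1, xor a.2.2 (f a.2.1)))

/-- The state of the memory after `t` queries, for the input `|0⟩^{⊗ k}`. -/
def OracleAlgorithm.state {n k : ℕ} (S : OracleAlgorithm n k) (f : Bits n → Bool)
    (t : Fin (S.queries + 1)) : Matrix (S.mem t).Basis (S.mem t).Basis ℂ :=
  Fin.induction (motive := fun t => Matrix (S.mem t).Basis (S.mem t).Basis ℂ)
    (dephase (S.init.apply (proj fun _ => false)))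
    (fun t ρ => dephase ((S.post t).apply (oracleCall f ((S.pre t).apply ρ))))
    t

/-- The probability that the algorithm outputs `1`. -/
def OracleAlgorithm.acceptProb {n k : ℕ} (S : OracleAlgorithm n k) (f : Bits n → Bool) : ℝ :=
  (S.out.apply (S.state f (Fin.last S.queries)) true true).re

/-- The algorithm keeps at most `s` qubits at the points where its memory bound applies; a point is
given by the number of queries made so far. -/
def OracleAlgorithm.HasQMemory {n k : ℕ} (S : OracleAlgorithm n k) (pts : Set ℕ) (s : ℕ) : Prop :=
  ∀ t : Fin (S.queries + 1), t.val ∈ pts → (S.mem t).qu ≤ s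

/-! ### BQS obfuscation -/

/-- `O` is a `(q, r, s)`-BQS obfuscator of the class `𝓕`; the bounds `q, r, s` may depend on the
size of the circuit. `pts` is the set of points at which the memory bound applies to the
simulator. -/
structure IsBQSObfuscator (pts : Set ℕ) (q r s : ℕ → ℕ)
    (𝓕 : (n : ℕ) → Set (BoolCircuit n)) (O : (n : ℕ) → BoolCircuit n → Transmission) : Prop where
  /-- A receiver with qmemory `r` learns the value of `C` at an input `x` of its choice. -/
  functionality : ∃ E : (n : ℕ) → Bits n → (k : ℕ) → (sh : Shape) → Receiver sh,
    (∀ n x k sh, (E n x k sh).HasQMemory (r k)) ∧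
    ∃ D : (n : ℕ) → (x : Bits n) → (k : ℕ) → (sh : Shape) → QChannel (E n x k sh).final.Basis Bool,
    ∃ ε : ℕ → ℝ, Negligible ε ∧ ∀ n, ∀ C ∈ 𝓕 n, ∀ x,
      1 - ε C.size ≤ outputProb (O n C) (E n x C.size (O n C).shape)
        (D n x C.size (O n C).shape) (C.eval x)
  /-- Polynomial slowdown. -/
  slowdown : ∃ p : Polynomial ℕ, ∀ n, ∀ C ∈ 𝓕 n, (O n C).qubits ≤ p.eval C.size
  /-- The sender needs qmemory `q`. -/
  sender : ∀ n, ∀ C ∈ 𝓕 n, ∀ i, ((O n C).mem i).qu ≤ q C.size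
  /-- Every adversary with qmemory `s` (a receiving strategy followed by a measurement) is simulated
  with polynomially many oracle queries. -/
  security : ∀ (A : ReceiverFamily s)
    (D : (n k : ℕ) → (sh : Shape) → QChannel (A.recv n k sh).final.Basis Bool),
    ∃ S : (n k : ℕ) → OracleAlgorithm n k,
      (∀ n k, (S n k).HasQMemory pts (s k)) ∧
      (∃ p : Polynomial ℕ, ∀ n k, (S n k).queries ≤ p.eval k) ∧
      ∃ ε : ℕ → ℝ, Negligible ε ∧ ∀ n, ∀ C ∈ 𝓕 n,
        |outputProb (O n C) (A.recv n C.size (O n C).shape) (D n C.size (O n C).shape) true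
          - (S n C.size).acceptProb C.eval| ≤ ε C.size

end BQS

end

noncomputable section

open Matrix
open scoped ComplexOrder MatrixOrder

namespace BQS

/-! ### Effects, their operator order, and their realisation by channels -/

section Effects

variable {α β : Type} [Fintype α] [DecidableEq α]

/-! A stored program allows an unbounded receiver to test a property of the whole truth table of `C`
in one measurement, while polynomially many oracle queries cannot.

Consider the intervals `[2j, 2j+1]` and a set `J` of indices. Let `M j` be the effect "the stored
program outputs 1 at the input `2j`". These effects need not commute, so their disjunction is
replaced by `T = 1 - (1 + S)⁻¹` with `S = ∑ j ∈ J, M j`. It satisfies `T ≤ S` and `M j ≤ 2 T`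
(`exists_effect_between`). With evaluation error `δ`, measuring `T` accepts with probability at
least `(1 - δ) / 2` if the hidden index lies in `J`, and at most `|J| δ` otherwise
(`exists_channel_detecting`). As `δ` is negligible, `J` can be superpolynomially large.

By security a simulator with polynomially many queries must also separate the indices in `J` from
those outside. The intervals have disjoint supports, so by the hybrid argument for quantum search
`q` queries tell only `O(q²)` of them apart from the zero function
(`OracleAlgorithm.card_le_of_distinguishes`). Whatever the simulator does on the zero function, it
must deviate from it on all of `J` or on all of an equally large set outside `J`, a contradiction.
The simulator depends on the input length and `|C|` only, so all intervals used must have circuits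
of one size; the pigeonhole principle provides them (`exists_common_size`). -/

theorem posSemidef_mul_one_sub {M : Matrix α α ℂ} (hM : M.PosSemidef)
    (hM' : (1 - M).PosSemidef) : (M * (1 - M)).PosSemidef := by
  have h₁ := hM.mul_mul_conjTranspose_same (1 - M)
  have h₂ := hM'.mul_mul_conjTranspose_same M
  rw [hM'.isHermitian.eq] at h₁
  rw [hM.isHermitian.eq] at h₂
  convert h₁.add h₂ using 1
  noncomm_ring

/-- For `0 ≤ M ≤ 1` and `M ≤ S`, one has `M ≤ 2 (1 - (1 + S)⁻¹)`. -/
theorem posSemidef_two_one_sub_inv_sub {M S : Matrix α α ℂ} (hM : M.PosSemidef)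
    (hM' : (1 - M).PosSemidef) (hS : (S - M).PosSemidef) :
    ((2 : ℝ) • (1 - (1 + S)⁻¹) - M).PosSemidef := by
  have hSp : S.PosSemidef := by simpa using hS.add hM
  -- `N = 1 - M / 2`, so the claim is `(1 + S)⁻¹ ≤ N`. It follows from `N⁻¹ ≤ 1 + M ≤ 1 + S`, since
  -- inversion reverses the operator order.
  set N : Matrix α α ℂ := (1 / 2 : ℝ) • (1 + (1 - M)) with hN
  have hNd : N.PosDef := (PosDef.one.add_posSemidef hM').smul (by norm_num)
  have hA : (1 + S).PosDef := PosDef.one.add_posSemidef hSp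
  let _ := hNd.isUnit.invertible
  let _ := hA.isUnit.invertible
  have hNN : N * N⁻¹ = 1 := mul_inv_of_invertible N
  have hNN' : N⁻¹ * N = 1 := inv_mul_of_invertible N
  have key : ((1 + M) - N⁻¹).PosSemidef := by
    have h₁ := posSemidef_mul_one_sub hM hM'
    have h₂ := hM.mul_mul_conjTranspose_same (1 - M)
    rw [hM'.isHermitian.eq] at h₂
    have h₃ := ((h₁.add h₂).smul (show (0 : ℝ) ≤ 1 / 4 by norm_num)).mul_mul_conjTranspose_same N⁻¹
    rw [hNd.inv.isHermitian.eq] at h₃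
    convert h₃ using 1
    -- For commuting variables this reads `(1 - m/2)² (1 + m) - (1 - m/2) = m (1 - m) (2 - m) / 4`,
    -- which is nonnegative on `[0, 1]`.
    have : (1 / 4 : ℝ) • (M * (1 - M) + (1 - M) * M * (1 - M)) = N * (1 + M) * N - N := by
      rw [hN]
      simp only [smul_mul_assoc, mul_smul_comm, smul_smul]
      have : (1 / 2 : ℝ) • (1 + (1 - M)) = (1 / 4 : ℝ) • ((2 : ℝ) • (1 + (1 - M))) := by
        rw [smul_smul]; norm_num
      rw [this]
      norm_num only
      rw [← smul_sub, two_smul]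
      congr 1
      noncomm_ring
    rw [this]
    calc (1 + M) - N⁻¹ = (N⁻¹ * N) * (1 + M) * (N * N⁻¹) - N⁻¹ * (N * N⁻¹) := by
          rw [hNN, hNN']; simp
      _ = _ := by noncomm_ring
  have h : ((1 + S) - 1 * N⁻¹ * 1ᴴ).PosSemidef := by
    convert key.add hS using 1
    simp only [conjTranspose_one, one_mul, mul_one]
    abel
  -- The two Schur complements of the block matrix with diagonal `1 + S`, `N` and off-diagonal
  -- blocks `1` turn `N⁻¹ ≤ 1 + S` into `(1 + S)⁻¹ ≤ N`.
  rw [← PosDef.fromBlocks₂₂ _ _ hNd, PosDef.fromBlocks₁₁ _ _ hA] at h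
  have h' : (2 : ℝ) • (1 - (1 + S)⁻¹) - M = (2 : ℝ) • (N - 1ᴴ * (1 + S)⁻¹ * 1) := by
    simp only [conjTranspose_one, one_mul, mul_one, hN, smul_sub, smul_smul]
    norm_num
    rw [two_smul]
    abel
  rw [h']
  exact h.smul (by norm_num)

/-- A finite family of effects admits an effect that is below the sum of the family and above half
of each of its members. -/
theorem exists_effect_between {ι : Type} (J : Finset ι) (M : ι → Matrix α α ℂ)
    (hM : ∀ i, (M i).PosSemidef) (hM' : ∀ i, (1 - M i).PosSemidef) :
    ∃ T : Matrix α α ℂ, T.PosSemidef ∧ (1 - T).PosSemidef ∧ (∑ i ∈ J, M i - T).PosSemidef ∧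
      ∀ j ∈ J, ((2 : ℝ) • T - M j).PosSemidef := by
  classical
  set S := ∑ i ∈ J, M i with hSdef
  have hS : S.PosSemidef := posSemidef_sum _ fun i _ => hM i
  have hA : (1 + S).PosDef := PosDef.one.add_posSemidef hS
  let _ := hA.isUnit.invertible
  set E := (1 + S)⁻¹ with hE
  have h1 : (1 + S) * E = 1 := mul_inv_of_invertible _
  have h2 : E * (1 + S) = 1 := inv_mul_of_invertible _
  have hEh : Eᴴ = E := hA.inv.isHermitian.eq
  have hSS : (S * S).PosSemidef := by
    have := posSemidef_conjTranspose_mul_self S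
    rwa [hS.isHermitian.eq] at this
  have hSSS : (S * S * S).PosSemidef := by
    have := hS.mul_mul_conjTranspose_same S
    rwa [hS.isHermitian.eq] at this
  -- The witness is `S (1 + S)⁻¹`. The first two nontrivial bounds come from `1 - E = E (S + S²) E`
  -- and `S - (1 - E) = E (S² + S³) E`.
  refine ⟨1 - E, ?_, by simpa using hA.inv.posSemidef, ?_, fun j hj => ?_⟩
  · have := (hS.add hSS).mul_mul_conjTranspose_same E
    rw [hEh] at this
    convert this using 1
    calc 1 - E = (E * (1 + S)) * ((1 + S) * E) - (E * (1 + S)) * E := by rw [h1, h2]; simp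
      _ = _ := by noncomm_ring
  · have := (hSS.add hSSS).mul_mul_conjTranspose_same E
    rw [hEh] at this
    convert this using 1
    calc S - (1 - E) = (E * (1 + S)) * S * ((1 + S) * E) -
          ((E * (1 + S)) * ((1 + S) * E) - (E * (1 + S)) * E) := by rw [h1, h2]; simp
      _ = _ := by noncomm_ring
  · refine posSemidef_two_one_sub_inv_sub (hM j) (hM' j) ?_
    rw [hSdef, ← Finset.add_sum_erase _ _ hj, add_sub_cancel_left]
    exact posSemidef_sum _ fun i _ => hM i

/-- The trace of a product of two positive semidefinite matrices is nonnegative. -/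
theorem trace_mul_re_nonneg {T ρ : Matrix α α ℂ} (hT : T.PosSemidef) (hρ : ρ.PosSemidef) :
    0 ≤ (T * ρ).trace.re := by
  obtain ⟨B, rfl⟩ := CStarAlgebra.nonneg_iff_eq_star_mul_self.mp hT.nonneg
  rw [star_eq_conjTranspose, trace_mul_comm, ← mul_assoc, trace_mul_comm, ← mul_assoc]
  exact (Complex.le_def.mp (hρ.mul_mul_conjTranspose_same B).trace_nonneg).1

/-- Every effect is the acceptance event of a channel with one-qubit output. -/
theorem exists_channel_of_effect {T : Matrix α α ℂ} (hT : T.PosSemidef)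
    (hT' : (1 - T).PosSemidef) :
    ∃ D : QChannel α Bool, ∀ ρ, D.apply ρ true true = (T * ρ).trace := by
  obtain ⟨A, hA⟩ := CStarAlgebra.nonneg_iff_eq_star_mul_self.mp hT.nonneg
  obtain ⟨B, hB⟩ := CStarAlgebra.nonneg_iff_eq_star_mul_self.mp hT'.nonneg
  let X : Bool → Matrix α α ℂ := fun b => if b then A else B
  -- The Kraus operators are `|b⟩⟨i| X b`: apply the square-root factor of the outcome `b`, discard
  -- the system and record `b`.
  let K : Bool × α → Matrix Bool α ℂ :=
    fun i => Matrix.of fun b a => if b = i.1 then X i.1 i.2 a else 0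
  let e := Fintype.equivFin (Bool × α)
  refine ⟨⟨Fintype.card (Bool × α), fun i => K (e.symm i), ?_⟩, fun ρ => ?_⟩
  · rw [e.symm.sum_comp fun i => (K i)ᴴ * K i]
    have h : (1 : Matrix α α ℂ) = star A * A + star B * B := by rw [← hA, ← hB]; abel
    rw [h]
    ext c d
    simp [K, X, Matrix.sum_apply, Matrix.mul_apply, Fintype.sum_prod_type, star_eq_conjTranspose]
  · change (∑ i, K (e.symm i) * ρ * (K (e.symm i))ᴴ) true true = _
    rw [e.symm.sum_comp fun i => K i * ρ * (K i)ᴴ, hA, star_eq_conjTranspose, trace_mul_comm,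
      ← mul_assoc, trace_mul_comm, ← mul_assoc]
    simp [K, X, Matrix.sum_apply, Matrix.mul_apply, Fintype.sum_prod_type, Matrix.trace]

/-- The effect of accepting when the second register holds the basis state `x`. -/
theorem exists_effect_of_channel [Fintype β] [DecidableEq β] (Φ : QChannel (α × β) Bool) (x : β) :
    ∃ M : Matrix α α ℂ, M.PosSemidef ∧ (1 - M).PosSemidef ∧
      ∀ ρ, Φ.apply (kroneckerMap (· * ·) ρ (proj x)) true true = (M * ρ).trace := by
  let V : Bool → Matrix (Fin Φ.num) α ℂ := fun b => Matrix.of fun i a => Φ.kraus i b (a, x)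
  have hV : (V true)ᴴ * V true + (V false)ᴴ * V false = 1 := by
    ext c d
    have h := congrFun (congrFun Φ.complete (c, x)) (d, x)
    simp only [Matrix.sum_apply, Matrix.mul_apply, Fintype.sum_bool, conjTranspose_apply,
      Finset.sum_add_distrib] at h
    simp only [V, Matrix.add_apply, Matrix.mul_apply, conjTranspose_apply, of_apply, h]
    simp [Matrix.one_apply]
  refine ⟨(V true)ᴴ * V true, posSemidef_conjTranspose_mul_self _, ?_, fun ρ => ?_⟩
  · rw [← hV, add_sub_cancel_left]
    exact posSemidef_conjTranspose_mul_self _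
  · rw [Matrix.trace_mul_comm, ← Matrix.mul_assoc, Matrix.trace_mul_comm, ← Matrix.mul_assoc]
    simp [V, QChannel.apply, Matrix.sum_apply, Matrix.mul_apply, Fintype.sum_prod_type,
      Matrix.trace, proj, Matrix.single_apply, ite_and]

/-- Diagonal entries are bounded by the trace norm. -/
theorem norm_apply_le_traceNorm (M : Matrix α α ℂ) (a : α) : ‖M a a‖ ≤ traceNorm M := by
  have hH := isHermitian_mul_conjTranspose_self M
  have hP := posSemidef_self_mul_conjTranspose M
  have h0 : ∀ i, 0 ≤ hH.eigenvalues i := fun i => hP.eigenvalues_nonneg i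
  have ht : 0 ≤ traceNorm M := Finset.sum_nonneg fun i _ => Real.sqrt_nonneg _
  refine abs_le_of_sq_le_sq' ?_ ht |>.2
  -- Both sides are `tr (M Mᴴ)`; the diagonal entry is compared with the trace norm through the
  -- Frobenius norm.
  have h1 : ((∑ c, ∑ b, ‖M c b‖ ^ 2 : ℝ) : ℂ) = ((∑ i, hH.eigenvalues i : ℝ) : ℂ) := by
    have := hH.trace_eq_sum_eigenvalues
    simp only [Matrix.trace, Matrix.diag, Matrix.mul_apply, conjTranspose_apply] at this
    push_cast
    refine Eq.trans ?_ this
    refine Finset.sum_congr rfl fun c _ => Finset.sum_congr rfl fun b _ => ?_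
    exact (Complex.mul_conj' _).symm
  calc ‖M a a‖ ^ 2 ≤ ∑ b, ‖M a b‖ ^ 2 :=
        Finset.single_le_sum (f := fun b => ‖M a b‖ ^ 2) (fun _ _ => by positivity)
          (Finset.mem_univ a)
    _ ≤ ∑ c, ∑ b, ‖M c b‖ ^ 2 :=
        Finset.single_le_sum (f := fun c => ∑ b, ‖M c b‖ ^ 2) (fun _ _ => by positivity)
          (Finset.mem_univ a)
    _ = ∑ i, hH.eigenvalues i := Complex.ofReal_injective h1
    _ = ∑ i, √(hH.eigenvalues i) ^ 2 :=
        Finset.sum_congr rfl fun i _ => (Real.sq_sqrt (h0 i)).symm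
    _ ≤ (∑ i, √(hH.eigenvalues i)) ^ 2 :=
        Finset.sum_sq_le_sq_sum_of_nonneg fun i _ => Real.sqrt_nonneg _

end Effects

/-! ### Positivity of the states arising in a transmission -/

section Positivity

variable {α β γ : Type} [Fintype α] [DecidableEq α] [Fintype β]

/-- Pinching with respect to a partition of the basis preserves positivity. -/
theorem posSemidef_pinching {κ : Type} [Fintype κ] [DecidableEq κ] (g : α → κ)
    {ρ : Matrix α α ℂ} (hρ : ρ.PosSemidef) :
    (Matrix.of fun a b => if g a = g b then ρ a b else 0).PosSemidef := by
  have h : (Matrix.of fun a b => if g a = g b then ρ a b else 0) =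
      ∑ y : κ, diagonal (fun a => if g a = y then (1 : ℂ) else 0) * ρ *
        (diagonal (fun a => if g a = y then (1 : ℂ) else 0))ᴴ := by
    ext a b
    simp [Matrix.sum_apply, diagonal_conjTranspose, mul_diagonal, diagonal_mul]
  rw [h]
  exact posSemidef_sum _ fun y _ => hρ.mul_mul_conjTranspose_same _

theorem QChannel.apply_posSemidef (Φ : QChannel α β) {ρ : Matrix α α ℂ} (hρ : ρ.PosSemidef) :
    (Φ.apply ρ).PosSemidef :=
  posSemidef_sum _ fun _ _ => hρ.mul_mul_conjTranspose_same _

theorem QChannel.trace_apply (Φ : QChannel α β) (ρ : Matrix α α ℂ) :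
    (Φ.apply ρ).trace = ρ.trace := by
  have h : ∀ i, (Φ.kraus i * ρ * (Φ.kraus i)ᴴ).trace =
      ((Φ.kraus i)ᴴ * Φ.kraus i * ρ).trace := fun i => by
    rw [Matrix.trace_mul_comm, ← Matrix.mul_assoc]
  rw [QChannel.apply, trace_sum, Finset.sum_congr rfl fun i _ => h i, ← trace_sum,
    ← Finset.sum_mul, Φ.complete, one_mul]

theorem QChannel.applyLeft_posSemidef [Fintype γ] [DecidableEq γ] (Φ : QChannel α β)
    {ρ : Matrix (α × γ) (α × γ) ℂ} (hρ : ρ.PosSemidef) : (Φ.applyLeft ρ).PosSemidef :=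
  posSemidef_sum _ fun _ _ => hρ.mul_mul_conjTranspose_same _

theorem QChannel.applyRight_posSemidef [Fintype γ] [DecidableEq γ] (Φ : QChannel α β)
    {ρ : Matrix (γ × α) (γ × α) ℂ} (hρ : ρ.PosSemidef) : (Φ.applyRight ρ).PosSemidef :=
  posSemidef_sum _ fun _ _ => hρ.mul_mul_conjTranspose_same _

theorem dephase_posSemidef {M : CQReg} {ρ : Matrix M.Basis M.Basis ℂ} (hρ : ρ.PosSemidef) :
    (dephase ρ).PosSemidef :=
  posSemidef_pinching Prod.fst hρ

theorem trace_dephase {M : CQReg} (ρ : Matrix M.Basis M.Basis ℂ) :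
    (dephase ρ).trace = ρ.trace := by
  simp [Matrix.trace, dephase]

theorem dephase₂_posSemidef {M N : CQReg}
    {ρ : Matrix (M.Basis × N.Basis) (M.Basis × N.Basis) ℂ} (hρ : ρ.PosSemidef) :
    (dephase₂ ρ).PosSemidef := by
  have h := posSemidef_pinching (fun a : M.Basis × N.Basis => (a.1.1, a.2.1)) hρ
  simp only [Prod.mk.injEq] at h
  exact h

theorem traceLeft_posSemidef {ι κ : Type} [Fintype ι] {ρ : Matrix (ι × κ) (ι × κ) ℂ}
    (hρ : ρ.PosSemidef) :
    (traceLeft ρ).PosSemidef := by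
  have h : traceLeft ρ = ∑ a : ι, ρ.submatrix (fun b => (a, b)) fun b => (a, b) := by
    ext b b'
    simp [traceLeft, Matrix.sum_apply]
  rw [h]
  exact posSemidef_sum _ fun a _ => hρ.submatrix _

theorem jointState_posSemidef (Θ : Transmission) (A : Receiver Θ.shape)
    (i : Fin (Θ.shape.rounds + 1)) : (jointState Θ A i).PosSemidef := by
  induction i using Fin.induction with
  | zero =>
    exact dephase₂_posSemidef
      ((Θ.init.apply_posSemidef .one).kronecker (A.init.apply_posSemidef .one))
  | succ i ih =>
    exact dephase₂_posSemidef ((A.step i).applyRight_posSemidef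
      (((Θ.step i).applyLeft_posSemidef ih).submatrix _))

theorem storedState_posSemidef (Θ : Transmission) (A : Receiver Θ.shape) :
    (storedState Θ A).PosSemidef :=
  traceLeft_posSemidef (jointState_posSemidef Θ A _)

end Positivity

/-! ### How much a permutation of the basis can change an acceptance probability -/

section Hybrid

variable {α β : Type} [Fintype α] [Fintype β]

/-- A real-linear map that preserves positivity and the trace. -/
structure IsPTP (L : Matrix α α ℂ → Matrix β β ℂ) : Prop where
  map_add : ∀ ρ σ, L (ρ + σ) = L ρ + L σ
  map_smul : ∀ (c : ℝ) ρ, L (c • ρ) = c • L ρ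
  posSemidef : ∀ ρ, ρ.PosSemidef → (L ρ).PosSemidef
  trace_map : ∀ ρ, (L ρ).trace = ρ.trace

/-- A real-linear functional with values in `[0, 1]` on states. -/
structure IsEffect (φ : Matrix α α ℂ → ℝ) : Prop where
  map_add : ∀ ρ σ, φ (ρ + σ) = φ ρ + φ σ
  map_smul : ∀ (c : ℝ) ρ, φ (c • ρ) = c * φ ρ
  nonneg : ∀ ρ, ρ.PosSemidef → 0 ≤ φ ρ
  le_trace : ∀ ρ, ρ.PosSemidef → φ ρ ≤ ρ.trace.re

theorem IsEffect.comp {φ : Matrix β β ℂ → ℝ} (hφ : IsEffect φ)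
    {L : Matrix α α ℂ → Matrix β β ℂ} (hL : IsPTP L) : IsEffect fun ρ => φ (L ρ) where
  map_add ρ σ := by simp only [hL.map_add, hφ.map_add]
  map_smul c ρ := by simp only [hL.map_smul, hφ.map_smul]
  nonneg ρ hρ := hφ.nonneg _ (hL.posSemidef _ hρ)
  le_trace ρ hρ := (hφ.le_trace _ (hL.posSemidef _ hρ)).trans_eq (by rw [hL.trace_map])

theorem QChannel.isPTP [DecidableEq α] (Φ : QChannel α β) : IsPTP Φ.apply where
  map_add ρ σ := by simp [QChannel.apply, Matrix.mul_add, Matrix.add_mul, Finset.sum_add_distrib]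
  map_smul c ρ := by simp [QChannel.apply, Finset.smul_sum]
  posSemidef _ := Φ.apply_posSemidef
  trace_map := Φ.trace_apply

theorem dephase_isPTP (M : CQReg) : IsPTP (dephase (M := M)) where
  map_add ρ σ := by ext a b; by_cases h : a.1 = b.1 <;> simp [dephase, h]
  map_smul c ρ := by ext a b; by_cases h : a.1 = b.1 <;> simp [dephase, h]
  posSemidef _ := dephase_posSemidef
  trace_map := trace_dephase

theorem submatrix_isPTP (e : α ≃ α) : IsPTP fun ρ : Matrix α α ℂ => ρ.submatrix e e where
  map_add _ _ := rfl
  map_smul _ _ := rfl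
  posSemidef _ h := h.submatrix _
  trace_map ρ := e.sum_comp fun a => ρ a a

/-- The oracle unitary as a permutation of the basis. -/
def oraclePerm {n : ℕ} (W : Type) (f : Bits n → Bool) :
    (W × Bits n × Bool) ≃ (W × Bits n × Bool) where
  toFun a := (a.1, a.2.1, xor a.2.2 (f a.2.1))
  invFun a := (a.1, a.2.1, xor a.2.2 (f a.2.1))
  left_inv a := by simp
  right_inv a := by simp

theorem acceptance_isEffect [DecidableEq α] (D : QChannel α Bool) :
    IsEffect fun ρ => (D.apply ρ true true).re where
  map_add ρ σ := by rw [D.isPTP.map_add]; rfl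
  map_smul c ρ := by rw [D.isPTP.map_smul]; simp
  nonneg ρ hρ := (Complex.le_def.mp (D.apply_posSemidef hρ).diag_nonneg).1
  le_trace ρ hρ := by
    rw [← D.trace_apply]
    have : 0 ≤ (D.apply ρ false false).re :=
      (Complex.le_def.mp (D.apply_posSemidef hρ).diag_nonneg).1
    simp only [Matrix.trace, Fintype.sum_bool, Matrix.diag, Complex.add_re]
    linarith

/-- The weight of a state on a set of basis elements. -/
def weight (σ : Matrix α α ℂ) (P : α → Prop) [DecidablePred P] : ℝ :=
  ∑ a, if P a then (σ a a).re else 0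

theorem weight_submatrix (σ : Matrix α α ℂ) (P : α → Prop) [DecidablePred P] (e : α ≃ α)
    (hP : ∀ a, P (e a) ↔ P a) : weight (σ.submatrix e e) P = weight σ P := by
  rw [weight, weight, ← e.sum_comp fun a => if P a then (σ a a).re else 0]
  simp [hP]

/-- With `U` the permutation matrix of `e`, the rows of `U - 1` outside `P` vanish. On `P` the cross
terms are absorbed by the diagonal ones, and `e` preserves `P`, so both diagonal sums equal the
weight. -/
theorem trace_displacement_le [DecidableEq α] {σ : Matrix α α ℂ} (hσ : σ.PosSemidef)
    (P : α → Prop) [DecidablePred P] (e : α ≃ α) (he : ∀ a, ¬ P a → e a = a)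
    (hP : ∀ a, P (e a) ↔ P a) :
    (((1 : Matrix α α ℂ).submatrix e id - 1) * σ *
      ((1 : Matrix α α ℂ).submatrix e id - 1)ᴴ).trace.re ≤ 4 * weight σ P := by
  have hU : (1 : Matrix α α ℂ).submatrix e id * σ = σ.submatrix e id := by
    ext a b; simp [Matrix.mul_apply, Matrix.one_apply]
  have hU' : ∀ X : Matrix α α ℂ, X * ((1 : Matrix α α ℂ).submatrix e id)ᴴ = X.submatrix id e := by
    intro X; ext a b; simp [Matrix.mul_apply, Matrix.one_apply]
  set X : Matrix α α ℂ := ((1 : Matrix α α ℂ).submatrix e id - 1) * σ *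
    ((1 : Matrix α α ℂ).submatrix e id - 1)ᴴ with hX
  have h1 : ∀ a, (X a a).re ≤
      (if P a then 2 * (σ (e a) (e a)).re else 0) + (if P a then 2 * (σ a a).re else 0) := by
    intro a
    have hval : X a a = σ (e a) (e a) - σ a (e a) - (σ (e a) a - σ a a) := by
      rw [hX, conjTranspose_sub, Matrix.mul_sub, hU', conjTranspose_one, Matrix.mul_one,
        Matrix.sub_mul, hU, Matrix.one_mul]
      simp only [Matrix.sub_apply, submatrix_apply, id]
    rw [hval]
    by_cases ha : P a
    -- Positivity on `|a⟩ + |e a⟩` bounds minus the cross terms by the diagonal terms.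
    · have h := hσ.dotProduct_mulVec_nonneg (Pi.single a 1 + Pi.single (e a) 1)
      have h' := (Complex.le_def.mp h).1
      simp only [star_add, Pi.star_single, star_one, mulVec_add, mulVec_single_one, add_dotProduct,
        dotProduct_add, single_one_dotProduct, Matrix.col_apply, Complex.add_re,
        Complex.zero_re] at h'
      simp only [ha, if_true, Complex.sub_re]
      linarith
    · simp [ha, he a ha]
  calc _ ≤ ∑ a, ((if P a then 2 * (σ (e a) (e a)).re else 0) +
        (if P a then 2 * (σ a a).re else 0)) := by
        rw [Matrix.trace, Complex.re_sum]
        exact Finset.sum_le_sum fun a _ => h1 a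
    _ = 2 * weight (σ.submatrix e e) P + 2 * weight σ P := by
        simp only [weight, Finset.mul_sum, mul_ite, mul_zero, Finset.sum_add_distrib,
          submatrix_apply]
    _ = 4 * weight σ P := by rw [weight_submatrix σ P e hP]; ring

/-- A weighted form of the Cauchy–Schwarz estimate that avoids square roots. The free parameter `c`
makes the bound linear in the weight, so that it can be summed over many functions. -/
theorem IsEffect.submatrix_le [DecidableEq α] {φ : Matrix α α ℂ → ℝ} (hφ : IsEffect φ)
    {σ : Matrix α α ℂ} (hσ : σ.PosSemidef) (hσ1 : σ.trace = 1)
    (P : α → Prop) [DecidablePred P] (e : α ≃ α) (he : ∀ a, ¬ P a → e a = a)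
    (hP : ∀ a, P (e a) ↔ P a) {c : ℝ} (hc : 0 < c) :
    φ (σ.submatrix e e) - φ σ ≤ c + 4 * (1 + c⁻¹) * weight σ P := by
  set U : Matrix α α ℂ := (1 : Matrix α α ℂ).submatrix e id with hU
  set X : Matrix α α ℂ := (U - 1) * σ * (U - 1)ᴴ with hX
  have hXp : X.PosSemidef := hσ.mul_mul_conjTranspose_same _
  have hXw : φ X ≤ 4 * weight σ P :=
    (hφ.le_trace _ hXp).trans (trace_displacement_le hσ P e he hP)
  have hUσ : σ.submatrix e e = U * σ * Uᴴ := by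
    ext a b; simp [hU, Matrix.mul_apply, Matrix.one_apply]
  have hY := hσ.mul_mul_conjTranspose_same (c • (1 : Matrix α α ℂ) - (U - 1))
  -- The terms linear in `U - 1` cancel. Dropping the positive first summand bounds `c φ(U σ Uᴴ)` by
  -- `(c² + c) φ(σ) + (1 + c) φ(X)`.
  have hsum : (c • (1 : Matrix α α ℂ) - (U - 1)) * σ * (c • (1 : Matrix α α ℂ) - (U - 1))ᴴ +
      c • σ.submatrix e e = (c * c + c) • σ + (1 + c) • X := by
    rw [hUσ, hX]
    simp only [conjTranspose_sub, conjTranspose_smul, conjTranspose_one, Matrix.mul_sub,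
      Matrix.sub_mul, Matrix.smul_mul, Matrix.mul_smul, Matrix.one_mul, Matrix.mul_one,
      star_trivial]
    module
  have h := congrArg φ hsum
  simp only [hφ.map_add, hφ.map_smul] at h
  have h0 := hφ.nonneg _ hY
  have h1 := hφ.le_trace _ hσ
  rw [hσ1, Complex.one_re] at h1
  have h2 : c * (φ (σ.submatrix e e) - φ σ) ≤ c * (c + (1 + c⁻¹) * φ X) := by
    have : c * (c + (1 + c⁻¹) * φ X) = c * c + (c + 1) * φ X := by field_simp
    rw [this]
    nlinarith
  have h3 := le_of_mul_le_mul_left h2 hc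
  have h4 : (1 + c⁻¹) * φ X ≤ (1 + c⁻¹) * (4 * weight σ P) :=
    mul_le_mul_of_nonneg_left hXw (by positivity)
  linarith

theorem IsEffect.abs_submatrix_sub_le [DecidableEq α] {φ : Matrix α α ℂ → ℝ} (hφ : IsEffect φ)
    {σ : Matrix α α ℂ} (hσ : σ.PosSemidef) (hσ1 : σ.trace = 1)
    (P : α → Prop) [DecidablePred P] (e : α ≃ α) (he : ∀ a, ¬ P a → e a = a)
    (hP : ∀ a, P (e a) ↔ P a) {c : ℝ} (hc : 0 < c) :
    |φ (σ.submatrix e e) - φ σ| ≤ c + 4 * (1 + c⁻¹) * weight σ P := by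
  refine abs_sub_le_iff.mpr ⟨hφ.submatrix_le hσ hσ1 P e he hP hc, ?_⟩
  -- The reverse inequality is the same bound for the permuted state and the inverse permutation.
  have h := hφ.submatrix_le (hσ.submatrix e) ((submatrix_isPTP e).trace_map σ |>.trans hσ1) P
    e.symm (fun a ha => by rw [Equiv.symm_apply_eq]; exact (he a ha).symm)
    (fun a => by rw [← hP, Equiv.apply_symm_apply]) hc
  rw [weight_submatrix σ P e hP] at h
  simpa using h

end Hybrid

/-! ### The hybrid argument for quantum queries -/

section QueryBound

variable {n k : ℕ}

theorem OracleAlgorithm.state_zero (S : OracleAlgorithm n k) (f : Bits n → Bool) :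
    S.state f 0 = dephase (S.init.apply (proj fun _ => false)) := rfl

theorem OracleAlgorithm.state_succ (S : OracleAlgorithm n k) (f : Bits n → Bool)
    (t : Fin S.queries) :
    S.state f t.succ = dephase ((S.post t).apply
      (((S.pre t).apply (S.state f t.castSucc)).submatrix (oraclePerm _ f) (oraclePerm _ f))) :=
  rfl

theorem submatrix_oraclePerm_false {W : Type}
    (ρ : Matrix (W × Bits n × Bool) (W × Bits n × Bool) ℂ) :
    ρ.submatrix (oraclePerm W fun _ => false) (oraclePerm W fun _ => false) = ρ := by
  ext a b
  simp [oraclePerm]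

theorem OracleAlgorithm.state_isState (S : OracleAlgorithm n k) (f : Bits n → Bool)
    (t : Fin (S.queries + 1)) : (S.state f t).PosSemidef ∧ (S.state f t).trace = 1 := by
  induction t using Fin.induction with
  | zero =>
    have h : (proj (fun _ : Fin k => false)).PosSemidef := by
      have := posSemidef_vecMulVec_self_star (R := ℂ) (Pi.single (fun _ : Fin k => false) 1)
      rwa [Pi.star_single, star_one, ← single_eq_single_vecMulVec_single] at this
    rw [S.state_zero]
    refine ⟨dephase_posSemidef (S.init.apply_posSemidef h), ?_⟩
    rw [trace_dephase, QChannel.trace_apply]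
    simp [proj]
  | succ t ih =>
    rw [S.state_succ]
    refine ⟨dephase_posSemidef ((S.post t).apply_posSemidef
      (((S.pre t).apply_posSemidef ih.1).submatrix (oraclePerm _ f))), ?_⟩
    rw [trace_dephase, QChannel.trace_apply, (submatrix_isPTP (oraclePerm _ f)).trace_map,
      QChannel.trace_apply, ih.2]

/-- The state at the time of query `t` when the oracle is the zero function. -/
def OracleAlgorithm.queryState (S : OracleAlgorithm n k) (t : Fin S.queries) :
    Matrix (Fin (S.work t) × Bits n × Bool) (Fin (S.work t) × Bits n × Bool) ℂ :=
  (S.pre t).apply (S.state (fun _ => false) t.castSucc)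

/-- The weight that query `t` puts on the support of `f` when the oracle is the zero function. -/
def OracleAlgorithm.queryWeight (S : OracleAlgorithm n k) (f : Bits n → Bool)
    (t : Fin S.queries) : ℝ :=
  weight (S.queryState t) fun a => f a.2.1 = true

/-- Oracle answers are replaced one query at a time. All weights are taken along the run with the
zero oracle, whose states do not depend on `f`, so they can later be summed over disjoint supports.
The effect is arbitrary so that the induction can pull it back through a query. -/
theorem OracleAlgorithm.abs_state_sub_le (S : OracleAlgorithm n k) (f : Bits n → Bool)
    {c : ℝ} (hc : 0 < c) (t : Fin (S.queries + 1))
    (φ : Matrix (S.mem t).Basis (S.mem t).Basis ℂ → ℝ) (hφ : IsEffect φ) :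
    |φ (S.state f t) - φ (S.state (fun _ => false) t)| ≤
      ∑ i with i.castSucc < t, (c + 4 * (1 + c⁻¹) * S.queryWeight f i) := by
  induction t using Fin.induction with
  | zero =>
    rw [S.state_zero, S.state_zero, sub_self, abs_zero]
    simp
  | succ t ih =>
    have hψ : IsEffect fun ρ => φ (dephase ((S.post t).apply ρ)) :=
      (hφ.comp (dephase_isPTP _)).comp (S.post t).isPTP
    have hψ' := (hψ.comp (submatrix_isPTP (oraclePerm _ f))).comp (S.pre t).isPTP
    have h1 := ih _ hψ'
    have hσ := S.state_isState (fun _ => false) t.castSucc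
    have h2 := hψ.abs_submatrix_sub_le ((S.pre t).apply_posSemidef hσ.1)
      (((S.pre t).trace_apply _).trans hσ.2) (fun a => f a.2.1 = true) (oraclePerm _ f)
      (fun a ha => by simp [oraclePerm, Bool.not_eq_true _ ▸ ha]) (fun a => Iff.rfl) hc
    have hfilter : (Finset.univ.filter fun i : Fin S.queries => i.castSucc < t.succ) =
        insert t (Finset.univ.filter fun i : Fin S.queries => i.castSucc < t.castSucc) := by
      ext i
      simp only [Finset.mem_filter, Finset.mem_univ, true_and, Finset.mem_insert, Fin.lt_def,
        Fin.ext_iff, Fin.val_succ, Fin.val_castSucc]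
      omega
    rw [hfilter, Finset.sum_insert (by simp), S.state_succ, S.state_succ,
      submatrix_oraclePerm_false, add_comm]
    exact (abs_sub_le _ _ _).trans (add_le_add h1 h2)

/-- Disjoint sets have total weight at most the trace. -/
theorem sum_weight_le {α ι : Type} [Fintype α] {σ : Matrix α α ℂ} (hσ : σ.PosSemidef)
    (H : Finset ι) (P : ι → α → Prop) [∀ i, DecidablePred (P i)]
    (hP : ∀ a i j, P i a → P j a → i = j) : ∑ i ∈ H, weight σ (P i) ≤ σ.trace.re := by
  simp only [weight]
  rw [Finset.sum_comm, Matrix.trace, Complex.re_sum]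
  refine Finset.sum_le_sum fun a _ => ?_
  have h0 : 0 ≤ (σ a a).re := (Complex.le_def.mp hσ.diag_nonneg).1
  rw [← Finset.sum_filter, Finset.sum_const, nsmul_eq_mul]
  have h1 : (Finset.card (H.filter fun i => P i a) : ℝ) ≤ 1 := by
    exact_mod_cast Finset.card_le_one.mpr fun i hi j hj =>
      hP a i j (Finset.mem_filter.mp hi).2 (Finset.mem_filter.mp hj).2
  exact mul_le_of_le_one_left h0 h1

/-- Few members of a family of functions with disjoint supports can be told apart from the zero
function with few queries. -/
theorem OracleAlgorithm.card_le_of_distinguishes {ι : Type} (S : OracleAlgorithm n k)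
    (H : Finset ι) (f : ι → Bits n → Bool)
    (hf : ∀ x i j, f i x = true → f j x = true → i = j)
    (hH : ∀ i ∈ H, 1 / 8 ≤ |S.acceptProb (f i) - S.acceptProb fun _ => false|) :
    H.card ≤ 64 * S.queries * (16 * S.queries + 17) := by
  set q := S.queries with hq
  -- This choice gives `q c ≤ 1/16`, half of the assumed gap `1/8`; the other half must be paid for
  -- by query weight, whose total over `H` is at most `q`.
  set c : ℝ := (16 * ((q : ℝ) + 1))⁻¹ with hc
  have hc0 : 0 < c := by positivity
  have hcinv : c⁻¹ = 16 * ((q : ℝ) + 1) := inv_inv _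
  have h1 : ∀ i ∈ H, 1 / 8 ≤ q * c + 4 * (1 + c⁻¹) * ∑ t, S.queryWeight (f i) t := by
    intro i hi
    refine (hH i hi).trans ((S.abs_state_sub_le (f i) hc0 _ _ (acceptance_isEffect S.out)).trans ?_)
    have : (Finset.univ.filter fun t : Fin S.queries => t.castSucc < Fin.last S.queries) =
        Finset.univ := Finset.filter_true_of_mem fun t _ => t.castSucc_lt_last
    rw [this, Finset.sum_add_distrib, Finset.mul_sum]
    simp [hq]
  have h2 : ∑ i ∈ H, ∑ t, S.queryWeight (f i) t ≤ q := by
    rw [Finset.sum_comm]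
    calc _ ≤ ∑ _t : Fin S.queries, (1 : ℝ) := by
          refine Finset.sum_le_sum fun t _ => ?_
          have hσ := S.state_isState (fun _ => false) t.castSucc
          refine (sum_weight_le ((S.pre t).apply_posSemidef hσ.1) H
            (fun i a => f i a.2.1 = true) fun a i j => hf a.2.1 i j).trans_eq ?_
          rw [QChannel.trace_apply, hσ.2, Complex.one_re]
      _ = q := by simp [hq]
  have h3 := Finset.sum_le_sum h1
  rw [Finset.sum_add_distrib, ← Finset.mul_sum _ _ (4 * (1 + c⁻¹))] at h3
  simp only [Finset.sum_const, nsmul_eq_mul] at h3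
  have hqc : q * c ≤ 1 / 16 := by
    rw [hc, ← div_eq_mul_inv, div_le_div_iff₀ (by positivity) (by norm_num)]
    linarith
  have h4 : 4 * (1 + c⁻¹) * ∑ i ∈ H, ∑ t, S.queryWeight (f i) t ≤ 4 * (1 + c⁻¹) * q :=
    mul_le_mul_of_nonneg_left h2 (by positivity)
  have h5 : (H.card : ℝ) * (q * c) ≤ H.card * (1 / 16) :=
    mul_le_mul_of_nonneg_left hqc (by positivity)
  rw [hcinv] at h3 h4
  have h6 : (H.card : ℝ) ≤ 64 * q * (16 * q + 17) := by linarith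
  exact_mod_cast h6

end QueryBound

/-! ### Negligible functions along a sequence of circuit sizes -/

section Asymptotics

open Filter Topology

theorem eval_mono_nat (R : Polynomial ℕ) {a b : ℕ} (h : a ≤ b) : R.eval a ≤ R.eval b := by
  rw [Polynomial.eval_eq_sum_range, Polynomial.eval_eq_sum_range]
  gcongr

/-- Circuit sizes are at least the input length `n + 1`, so decay in the size beats every polynomial
in the input length. -/
theorem Negligible.tendsto_eval_mul_abs {ε : ℕ → ℝ} (hε : Negligible ε) {k : ℕ → ℕ}
    (hk : ∀ n, n + 1 ≤ k n) (R : Polynomial ℕ) :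
    Tendsto (fun n : ℕ => ((R.eval (n + 1) : ℕ) : ℝ) * |ε (k n)|) atTop (𝓝 0) := by
  have hk' : Tendsto k atTop atTop :=
    tendsto_atTop_mono (fun n => (Nat.le_succ n).trans (hk n)) tendsto_id
  have h := (hε.polynomial_mul (R.map (Nat.castRingHom ℝ))) 0
  simp only [pow_zero, one_mul] at h
  have h' := (h.abs.comp hk')
  rw [abs_zero] at h'
  refine squeeze_zero (fun n => by positivity) (fun n => ?_) h'
  have hev : (Polynomial.map (Nat.castRingHom ℝ) R).eval ((k n : ℕ) : ℝ) = (R.eval (k n) : ℕ) := by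
    simp
  simp only [Function.comp, abs_mul, hev, Nat.abs_cast]
  gcongr
  exact eval_mono_nat R (hk n)

theorem negligible_half_pow : Negligible fun n => (1 / 2 : ℝ) ^ n := fun d =>
  tendsto_pow_const_mul_const_pow_of_abs_lt_one d (by norm_num [abs_of_pos])

theorem Negligible.tendsto_eval_mul_add {ε : ℕ → ℝ} (hε : Negligible ε) {k : ℕ → ℕ}
    (hk : ∀ n, n + 1 ≤ k n) (p R : Polynomial ℕ) :
    Tendsto (fun n : ℕ => ((R.eval (n + 1) : ℕ) : ℝ) *
      (|ε (k n)| + ((p.eval (n + 1) : ℕ) + 1) / 2 ^ n))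
      atTop (𝓝 0) := by
  have h := (hε.tendsto_eval_mul_abs hk R).add
    ((negligible_half_pow.tendsto_eval_mul_abs (fun n => le_refl (n + 1))
      (R * (p + 1))).const_mul 2)
  simp only [mul_zero, add_zero] at h
  refine h.congr fun n => ?_
  rw [abs_of_pos (show (0 : ℝ) < (1 / 2) ^ (n + 1) by positivity)]
  simp only [Polynomial.eval_mul, Polynomial.eval_add, Polynomial.eval_one]
  push_cast
  rw [pow_succ, one_div, inv_pow]
  field_simp

end Asymptotics

/-! ### Disjoint intervals of length two -/

section ShortIntervals

/-- The indicator function of the interval `[2 j, 2 j + 1]`. -/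
def shortInterval (n j : ℕ) (x : Bits n) : Bool := decide (Nat.ofBits x / 2 = j)

theorem isIntervalFunction_shortInterval {n j : ℕ} (hj : j < 2 ^ n) :
    IsIntervalFunction (shortInterval (n + 1) j) := by
  -- Interval functions require `a < b`, so pairs of consecutive integers take the place of single
  -- points.
  refine ⟨2 * j, 2 * j + 1, by omega, by rw [pow_succ]; omega, fun x => ?_⟩
  rw [shortInterval, decide_eq_decide]
  omega

/-- The bit string `2 j`. -/
def evenBits (n j : ℕ) : Bits n := fun i => (2 * j).testBit i

theorem shortInterval_evenBits {n i j : ℕ} (hi : i < 2 ^ n) :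
    shortInterval (n + 1) j (evenBits (n + 1) i) = decide (i = j) := by
  have h : Nat.ofBits (evenBits (n + 1) i) = 2 * i := by
    refine (Nat.ofBits_testBit _ _).trans (Nat.mod_eq_of_lt ?_)
    rw [pow_succ]
    omega
  rw [shortInterval, h, decide_eq_decide]
  omega

theorem le_of_netlist {n k : ℕ} (c : Netlist n k) : n ≤ k := by
  induction c with
  | inputs => exact le_rfl
  | gate _ _ _ _ ih => exact ih.trans (Nat.le_succ _)

/-- Many short intervals are computed by circuits of the class of one common size. -/
theorem exists_common_size {𝓘 : (n : ℕ) → Set (BoolCircuit n)} {p : Polynomial ℕ}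
    (hp : ∀ n, ∀ f : Bits n → Bool, IsIntervalFunction f →
      ∃ C ∈ 𝓘 n, C.eval = f ∧ C.size ≤ p.eval n) (n : ℕ) :
    ∃ (k : ℕ) (G : Finset ℕ), n + 1 ≤ k ∧ k ≤ p.eval (n + 1) ∧
      2 ^ n ≤ G.card * (p.eval (n + 1) + 1) ∧
      ∀ j ∈ G, j < 2 ^ n ∧
        ∃ C ∈ 𝓘 (n + 1), C.eval = shortInterval (n + 1) j ∧ C.size = k := by
  have h : ∀ j, ∃ k, j < 2 ^ n → n + 1 ≤ k ∧ k ≤ p.eval (n + 1) ∧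
      ∃ C ∈ 𝓘 (n + 1), C.eval = shortInterval (n + 1) j ∧ C.size = k := by
    intro j
    by_cases hj : j < 2 ^ n
    · obtain ⟨C, hC, hCe, hCs⟩ := hp _ _ (isIntervalFunction_shortInterval hj)
      exact ⟨C.size, fun _ => ⟨le_of_netlist C.net, hCs, C, hC, hCe, rfl⟩⟩
    · exact ⟨0, fun h => absurd h hj⟩
  choose size hsize using h
  have hmaps : ∀ j ∈ Finset.range (2 ^ n), size j ∈ Finset.range (p.eval (n + 1) + 1) :=
    fun j hj => Finset.mem_range.mpr
      (Nat.lt_succ_of_le (hsize j (Finset.mem_range.mp hj)).2.1)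
  -- Pigeonhole: `2 ^ n` indices are spread over at most `p(n + 1) + 1` sizes, so some size is
  -- attained at least the average number of times.
  obtain ⟨k, -, hk⟩ := Finset.exists_le_card_fiber_of_nsmul_le_card_of_maps_to
    (b := (2 ^ n : ℚ) / (p.eval (n + 1) + 1 : ℕ)) hmaps ⟨0, by simp⟩ (by
      rw [Finset.card_range, Finset.card_range, nsmul_eq_mul, mul_div_cancel₀ _ (by positivity)]
      simp)
  set G := (Finset.range (2 ^ n)).filter fun j => size j = k with hG
  have hmem : ∀ j ∈ G, j < 2 ^ n ∧ size j = k := fun j hj => by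
    simpa [hG] using hj
  have hcard : 2 ^ n ≤ G.card * (p.eval (n + 1) + 1) := by
    rw [div_le_iff₀ (by positivity)] at hk
    exact_mod_cast hk
  obtain ⟨j, hj⟩ : G.Nonempty := by
    rw [Finset.nonempty_iff_ne_empty]
    intro h0
    rw [h0] at hcard
    simp at hcard
  obtain ⟨hj1, rfl⟩ := hmem j hj
  refine ⟨size j, G, (hsize j hj1).1, (hsize j hj1).2.1, hcard, fun i hi => ?_⟩
  obtain ⟨hi1, hi2⟩ := hmem i hi
  exact ⟨hi1, hi2 ▸ (hsize i hi1).2.2⟩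

/-- An oracle algorithm that accepts the short intervals of `J` and rejects those of an at least
equally large set makes many queries. -/
theorem OracleAlgorithm.card_le_of_separates {n k : ℕ} (S : OracleAlgorithm n k)
    (J J' : Finset ℕ) (hcard : J.card ≤ J'.card)
    (hJ : ∀ j ∈ J, 13 / 32 ≤ S.acceptProb (shortInterval n j))
    (hJ' : ∀ j ∈ J', S.acceptProb (shortInterval n j) ≤ 1 / 8) :
    J.card ≤ 64 * S.queries * (16 * S.queries + 17) := by
  have hdisj : ∀ (x : Bits n) (i j : ℕ), shortInterval n i x = true →
      shortInterval n j x = true → i = j := by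
    intro x i j hi hj
    rw [shortInterval, decide_eq_true_iff] at hi hj
    exact hi.symm.trans hj
  -- `17/64` is the midpoint of `1/8` and `13/32`; its distance to either is `9/64 ≥ 1/8`.
  rcases le_total (S.acceptProb fun _ => false) (17 / 64) with h | h
  · refine S.card_le_of_distinguishes J (shortInterval n) hdisj fun j hj => ?_
    refine le_trans ?_ (le_abs_self _)
    linarith [hJ j hj]
  · refine hcard.trans (S.card_le_of_distinguishes J' (shortInterval n) hdisj fun j hj => ?_)
    refine le_trans ?_ (neg_le_abs _)
    linarith [hJ' j hj]

end ShortIntervals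

/-! ### The measurement built from a stored program -/

section Adversary

/-- From a stored program that evaluates `C` one obtains, for every set `J`, an event that is likely
when `C` accepts a single point of `J` and unlikely when `C` rejects all of `J`. -/
theorem exists_channel_detecting {α β ι : Type} [Fintype α] [DecidableEq α] [Fintype β]
    [DecidableEq β] (Φ : QChannel (α × β) Bool) (J : Finset ι) (x : ι → β) :
    ∃ D : QChannel α Bool, ∀ (ρ : Matrix α α ℂ) (g : β → Bool) (δ : ℝ), ρ.PosSemidef →
      (∀ y, traceNorm (Φ.apply (kroneckerMap (· * ·) ρ (proj y)) - proj (g y)) ≤ δ) →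
      (∀ j ∈ J, g (x j) = true → (1 - δ) / 2 ≤ (D.apply ρ true true).re) ∧
      ((∀ j ∈ J, g (x j) = false) → (D.apply ρ true true).re ≤ J.card * δ) := by
  choose M hM hM' hMt using fun j => exists_effect_of_channel Φ (x j)
  obtain ⟨T, hT, hT', hTS, hTM⟩ := exists_effect_between J M hM hM'
  obtain ⟨D, hD⟩ := exists_channel_of_effect hT hT'
  refine ⟨D, fun ρ g δ hρ hδ => ?_⟩
  have hent : ∀ j, |(M j * ρ).trace.re - if g (x j) then 1 else 0| ≤ δ := by
    intro j
    have h1 := (norm_apply_le_traceNorm _ true).trans (hδ (x j))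
    rw [Matrix.sub_apply, hMt] at h1
    refine le_trans ?_ ((Complex.abs_re_le_norm _).trans h1)
    rw [Complex.sub_re]
    cases g (x j) <;> simp [proj]
  rw [hD]
  refine ⟨fun j hj hg => ?_, fun hg => ?_⟩
  · have h := trace_mul_re_nonneg (hTM j hj) hρ
    rw [Matrix.sub_mul, Matrix.smul_mul, trace_sub, trace_smul, Complex.sub_re,
      Complex.smul_re, smul_eq_mul] at h
    have h2 := (abs_le.mp (hent j)).1
    simp only [hg, if_true] at h2
    linarith
  · have h := trace_mul_re_nonneg hTS hρ
    rw [Matrix.sub_mul, Matrix.sum_mul, trace_sub, trace_sum, Complex.sub_re, Complex.re_sum] at h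
    have h2 : ∑ j ∈ J, (M j * ρ).trace.re ≤ ∑ _j ∈ J, δ := Finset.sum_le_sum fun j hj => by
      have := (abs_le.mp (hent j)).2
      simpa [hg j hj] using this
    rw [Finset.sum_const, nsmul_eq_mul] at h2
    linarith

end Adversary

end BQS

end

/-! ### The adversary against the obfuscator and the contradiction -/

theorem mainTheorem5 (pts : Set ℕ) (q r s : ℕ → ℕ)
    (𝓘 : (n : ℕ) → Set (BQS.BoolCircuit n)) (h𝓘 : BQS.IsIntervalClass 𝓘)
    (O : (n : ℕ) → BQS.BoolCircuit n → BQS.Transmission)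
    (hO : BQS.IsBQSObfuscator pts q r s 𝓘 O) :
    ¬ ∃ (A : BQS.ReceiverFamily s)
        (A' : (n k : ℕ) → (sh : BQS.Shape) →
          BQS.QChannel ((A.recv n k sh).final.Basis × BQS.Bits n) Bool)
        (ε : ℕ → ℝ), BQS.Negligible ε ∧
        ∀ n, ∀ C ∈ 𝓘 n, ∀ x : BQS.Bits n,
          BQS.traceNorm
            ((A' n C.size (O n C).shape).apply
                (Matrix.kroneckerMap (· * ·)
                  (BQS.storedState (O n C) (A.recv n C.size (O n C).shape)) (BQS.proj x))
              - BQS.proj (C.eval x)) ≤ ε C.size := by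
  rintro ⟨A, A', ε, hε, hA⟩
  obtain ⟨-, p, hp⟩ := h𝓘
  choose k G hk hkp hG hGC using BQS.exists_common_size hp
  -- The second term keeps `E n` positive and, since `G n` has at least `2 ^ n / (p(n + 1) + 1)`
  -- elements, makes a set `J` of size about `1 / (16 E n)` fill at most half of `G n`.
  let E : ℕ → ℝ := fun n => |ε (k n)| + ((p.eval (n + 1) : ℕ) + 1) / 2 ^ n
  have hE : ∀ n, 0 < E n := fun n => by positivity
  have hJ : ∀ n, ∃ J ⊆ G n, J.card = ⌊(16 * E n)⁻¹⌋₊ ∧ J.card ≤ (G n \ J).card := by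
    intro n
    have h1 : 2 * ⌊(16 * E n)⁻¹⌋₊ ≤ (G n).card := by
      have h2 : ((⌊(16 * E n)⁻¹⌋₊ : ℕ) : ℝ) ≤ (16 * E n)⁻¹ :=
        Nat.floor_le (by have := hE n; positivity)
      have h3 : (2 : ℝ) ^ n ≤ (G n).card * ((p.eval (n + 1) : ℕ) + 1) := by exact_mod_cast hG n
      have h4 : (16 * E n)⁻¹ ≤ (G n).card / 2 := by
        have h5 : (16 * E n)⁻¹ ≤ (16 * (((p.eval (n + 1) : ℕ) + 1) / 2 ^ n : ℝ))⁻¹ :=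
          inv_anti₀ (by positivity)
            (mul_le_mul_of_nonneg_left (le_add_of_nonneg_left (abs_nonneg _)) (by norm_num))
        refine h5.trans ?_
        rw [← mul_div_assoc, inv_div, div_le_div_iff₀ (by positivity) (by norm_num)]
        nlinarith
      have : (2 * ⌊(16 * E n)⁻¹⌋₊ : ℝ) ≤ (G n).card := by linarith
      exact_mod_cast this
    obtain ⟨J, hJG, hJc⟩ := Finset.exists_subset_card_eq
      (show ⌊(16 * E n)⁻¹⌋₊ ≤ (G n).card by omega)
    exact ⟨J, hJG, hJc, by rw [Finset.card_sdiff_of_subset hJG]; omega⟩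
  choose J hJG hJc hJc' using hJ
  -- `J n` concerns inputs of length `n + 1`, hence the shift `n - 1`; the truncated value at length
  -- `0` plays no role.
  choose D hD using fun (n k : ℕ) (sh : BQS.Shape) =>
    BQS.exists_channel_detecting (A' n k sh) (J (n - 1)) (BQS.evenBits n)
  obtain ⟨S, -, ⟨P, hP⟩, ε', hε', hS⟩ := hO.security A D
  have hsep : ∀ n, E n ≤ 1 / 16 → |ε' (k n)| ≤ 1 / 16 →
      (J n).card ≤ 64 * (S (n + 1) (k n)).queries * (16 * (S (n + 1) (k n)).queries + 17) := by
    intro n hEn hεn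
    have hεE : ε (k n) ≤ E n := (le_abs_self _).trans (le_add_of_nonneg_right (by positivity))
    -- With evaluation and simulation errors at most `1/16`, acceptance on `J` is at least `(1 -
    -- 1/16)/2 - 1/16 = 13/32`. Outside `J` it is at most `|J| E n + 1/16 ≤ 1/8`.
    have key : ∀ j ∈ G n,
        (j ∈ J n → 13 / 32 ≤ (S (n + 1) (k n)).acceptProb (BQS.shortInterval (n + 1) j)) ∧
        (j ∉ J n → (S (n + 1) (k n)).acceptProb (BQS.shortInterval (n + 1) j) ≤ 1 / 8) := by
      intro j hj
      obtain ⟨hj1, C, hC, hCe, hCk⟩ := hGC n j hj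
      have h1 := hD (n + 1) C.size (O (n + 1) C).shape _ C.eval (ε C.size)
        (BQS.storedState_posSemidef _ _) (hA (n + 1) C hC)
      have h2 := abs_le.mp (hS (n + 1) C hC)
      have h3 : ε' C.size ≤ 1 / 16 := by rw [hCk]; exact (le_abs_self _).trans hεn
      have h4 : ε C.size ≤ E n := by rw [hCk]; exact hεE
      have hacc : (S (n + 1) (k n)).acceptProb (BQS.shortInterval (n + 1) j) =
          (S (n + 1) C.size).acceptProb C.eval := by rw [hCk, hCe]
      rw [hacc]
      rw [BQS.outputProb] at h2
      refine ⟨fun hjJ => ?_, fun hjJ => ?_⟩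
      · have h5 := h1.1 j hjJ (by rw [hCe, BQS.shortInterval_evenBits hj1]; simp)
        linarith
      · have h5 := h1.2 fun i hi => by
          rw [hCe, BQS.shortInterval_evenBits (hGC n i (hJG n hi)).1, decide_eq_false_iff_not]
          rintro rfl
          exact hjJ hi
        have h6 : ((J n).card : ℝ) * ε C.size ≤ 1 / 16 := by
          have h7 : ((J n).card : ℝ) ≤ (16 * E n)⁻¹ := by
            rw [hJc]
            exact Nat.floor_le (by have := hE n; positivity)
          calc ((J n).card : ℝ) * ε C.size ≤ (16 * E n)⁻¹ * E n :=
                (mul_le_mul_of_nonneg_left h4 (Nat.cast_nonneg _)).trans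
                  (mul_le_mul_of_nonneg_right h7 (hE n).le)
            _ = 1 / 16 := by
                have := (hE n).ne'
                field_simp
        simp only [Nat.add_sub_cancel] at h5
        linarith
    refine BQS.OracleAlgorithm.card_le_of_separates _ (J n) (G n \ J n) (hJc' n)
      (fun j hj => (key j (hJG n hj)).1 hj) fun j hj => ?_
    rw [Finset.mem_sdiff] at hj
    exact (key j hj.1).2 hj.2
  -- Since `k n ≤ p(n + 1)`, `Q` bounds the number of queries in terms of the input length.
  let Q : Polynomial ℕ := P.comp p
  -- The added `1` makes up for the floor in the size of `J`: it yields `1 / (16 E n) < R(n + 1)`,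
  -- although `R(n + 1) E n` tends to `0`.
  let R : Polynomial ℕ := 64 * Q * (16 * Q + 17) + 1
  have hlim := (hε.tendsto_eval_mul_add hk p R).eventually_lt_const
    (show (0 : ℝ) < 1 / 16 by norm_num)
  have hlimE := (hε.tendsto_eval_mul_add hk p 1).eventually_lt_const
    (show (0 : ℝ) < 1 / 16 by norm_num)
  have hlimε := (hε'.tendsto_eval_mul_abs hk 1).eventually_lt_const
    (show (0 : ℝ) < 1 / 16 by norm_num)
  obtain ⟨n, h1, h2, h3⟩ := (hlim.and (hlimE.and hlimε)).exists
  simp only [Polynomial.eval_one, Nat.cast_one, one_mul] at h2 h3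
  have h4 := hsep n h2.le h3.le
  have hq : (S (n + 1) (k n)).queries ≤ Q.eval (n + 1) := by
    rw [Polynomial.eval_comp]
    exact (hP _ _).trans (BQS.eval_mono_nat P (hkp n))
  have h5 : (J n).card + 1 ≤ R.eval (n + 1) := by
    have : R.eval (n + 1) = 64 * Q.eval (n + 1) * (16 * Q.eval (n + 1) + 17) + 1 := by
      simp [R]
    rw [this]
    exact Nat.succ_le_succ (h4.trans (by gcongr))
  have h6 : (16 * E n)⁻¹ < ((R.eval (n + 1) : ℕ) : ℝ) := by
    refine (Nat.lt_floor_add_one _).trans_le ?_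
    rw [← hJc n]
    exact_mod_cast h5
  rw [inv_lt_iff_one_lt_mul₀ (by have := hE n; positivity)] at h6
  change ((R.eval (n + 1) : ℕ) : ℝ) * E n < 1 / 16 at h1
  linarith
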